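/- Let $n\ge 3$. Let $\mathbb{L}(n)\subset\mathbb{C}^n$ be the set of all $n$-segments, i.e. of all $(z_1,\dots,z_n)\in\mathbb{C}^n$ such that the points $z_1,\dots,z_n$ lie on a common real line in the plane $\mathbb{C}$ and are not all equal, and let $\mathbb{M}(n)=\{(z_1,\dots,z_n)\in\mathbb{L}(n) : z_1=0\}$. Then $\mathbb{M}(n)$ and $\mathbb{L}(n)$ are smooth ($C^\infty$) real embedded submanifolds of $\mathbb{C}^n$, of real dimensions $n$ and $n+2$ respectively, and the map $$\mathbb{M}(n)\times\mathbb{C}\to\mathbb{L}(n),\qquad (Z,b)\mapsto Z+(b,\dots,b),$$ is a diffeomorphism. In particular $\mathbb{L}(n)$ is diffeomorphic to $\mathbb{M}(n)\times\mathbb{C}$. -/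

import Mathlib

open scoped Manifold ContDiff

/-- The diagonal of `ℂⁿ`: the polygons all of whose vertices coincide. -/
def polygonDiagonal (n : ℕ) : Set (Fin n → ℂ) :=
  Set.range fun (b : ℂ) (_ : Fin n) => b

/-- The space `𝕃(n) ⊂ ℂⁿ` of `n`-segments: polygons whose vertices lie on a common real line of
the plane, and do not all coincide. -/
def segmentSpace (n : ℕ) : Set (Fin n → ℂ) :=
  {z | Collinear ℝ (Set.range z) ∧ z ∉ polygonDiagonal n}

/-- The subspace `V_n ⊂ ℂⁿ` of polygons whose first vertex (the one of index `0`) is the origin. -/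
def firstVertexZero (n : ℕ) : Set (Fin n → ℂ) :=
  {z | ∀ i : Fin n, (i : ℕ) = 0 → z i = 0}

/-- The space `𝕄(n) = 𝕃(n) ∩ V_n` of `n`-segments whose first vertex is the origin. -/
def basedSegmentSpace (n : ℕ) : Set (Fin n → ℂ) :=
  segmentSpace n ∩ firstVertexZero n

/-- The given charts on the subset `S` (with its subspace topology) make `S` a smooth
`d`-dimensional embedded submanifold of the real normed space `E`: they are smoothly compatible,
and the inclusion `S → E` is a smooth embedding. (For given `S` there is at most one
smooth structure with this property.) -/
structure IsEmbeddedSubmanifold {E : Type*} [NormedAddCommGroup E] [NormedSpace ℝ E]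
    (d : ℕ) (S : Set E) [ChartedSpace (EuclideanSpace ℝ (Fin d)) S] : Prop where
  isManifold : IsManifold (𝓡 d) ∞ S
  isSmoothEmbedding : Manifold.IsSmoothEmbedding (𝓡 d) 𝓘(ℝ, E) ∞ (Subtype.val : S → E)

/-!
Around an `n`-segment whose vertices `0` and `k` differ, the coordinates `z 0`, `z k - z 0` and
`(z i - z 0) / (z k - z 0)`, for the remaining `i`, form a smooth chart of `ℂⁿ`. In it an `n`-tuple
is an `n`-segment exactly when the quotients are real, and it is based at the origin exactly when
moreover `z 0 = 0`. So both spaces are locally straightened to real subspaces, of dimensions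
`2 + 2 + (n - 2)` and `0 + 2 + (n - 2)`. The translation map and its inverse
`z ↦ (z - (z 0, …, z 0), z 0)` are restrictions of linear maps, hence smooth.
-/

open Module Set Topology

section SliceChart

variable {𝕜 E F G : Type*} [NontriviallyNormedField 𝕜] {r : ℕ∞ω}
  [NormedAddCommGroup E] [NormedSpace 𝕜 E] [NormedAddCommGroup F] [NormedSpace 𝕜 F]
  [NormedAddCommGroup G] [NormedSpace 𝕜 G]

/-- A slice chart at the point `x` of `S ⊆ E`: a `C^r` chart of `E` around `x` which, after the
linear identification `equiv` of `E` with `F × G`, straightens `S` to `F × {0}`. -/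
structure SliceChartAt (𝕜 : Type*) [NontriviallyNormedField 𝕜] (r : ℕ∞ω) {E : Type*} (F G : Type*)
    [NormedAddCommGroup E] [NormedSpace 𝕜 E] [NormedAddCommGroup F] [NormedSpace 𝕜 F]
    [NormedAddCommGroup G] [NormedSpace 𝕜 G] {S : Set E} (x : S) where
  ambient : OpenPartialHomeomorph E E
  equiv : (F × G) ≃L[𝕜] E
  mem_source : (x : E) ∈ ambient.source
  contDiffOn : ContDiffOn 𝕜 r ambient ambient.source
  contDiffOn_symm : ContDiffOn 𝕜 r ambient.symm ambient.target
  mem_iff : ∀ y ∈ ambient.source, y ∈ S ↔ (equiv.symm (ambient y)).2 = 0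

namespace SliceChartAt

variable {S : Set E} {x x' : S}

/-- The first component of a slice chart, which restricts to a chart of `S`. -/
def coord (c : SliceChartAt 𝕜 r F G x) (y : E) : F :=
  (c.equiv.symm (c.ambient y)).1

/-- The local parametrization of `S` given by the inverse of a slice chart. -/
def param (c : SliceChartAt 𝕜 r F G x) (u : F) : E :=
  c.ambient.symm (c.equiv (u, 0))

/-- The domain of the local parametrization `SliceChartAt.param`. -/
def paramSource (c : SliceChartAt 𝕜 r F G x) : Set F :=
  {u | c.equiv (u, 0) ∈ c.ambient.target}

theorem param_mem_source (c : SliceChartAt 𝕜 r F G x) {u : F} (hu : u ∈ c.paramSource) :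
    c.param u ∈ c.ambient.source :=
  c.ambient.map_target hu

theorem ambient_param (c : SliceChartAt 𝕜 r F G x) {u : F} (hu : u ∈ c.paramSource) :
    c.ambient (c.param u) = c.equiv (u, 0) :=
  c.ambient.right_inv hu

theorem coord_param (c : SliceChartAt 𝕜 r F G x) {u : F} (hu : u ∈ c.paramSource) :
    c.coord (c.param u) = u := by
  rw [coord, c.ambient_param hu, c.equiv.symm_apply_apply]

theorem param_mem (c : SliceChartAt 𝕜 r F G x) {u : F} (hu : u ∈ c.paramSource) :
    c.param u ∈ S := by
  rw [c.mem_iff _ (c.param_mem_source hu), c.ambient_param hu, c.equiv.symm_apply_apply]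

theorem equiv_coord (c : SliceChartAt 𝕜 r F G x) {y : E} (hy : y ∈ c.ambient.source)
    (hyS : y ∈ S) : c.equiv (c.coord y, 0) = c.ambient y := by
  rw [coord, ← (c.mem_iff y hy).1 hyS, Prod.mk.eta, c.equiv.apply_symm_apply]

theorem coord_mem_paramSource (c : SliceChartAt 𝕜 r F G x) {y : E} (hy : y ∈ c.ambient.source)
    (hyS : y ∈ S) : c.coord y ∈ c.paramSource := by
  rw [paramSource, mem_ofPred_eq, c.equiv_coord hy hyS]
  exact c.ambient.map_source hy

theorem param_coord (c : SliceChartAt 𝕜 r F G x) {y : E} (hy : y ∈ c.ambient.source)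
    (hyS : y ∈ S) : c.param (c.coord y) = y := by
  rw [param, c.equiv_coord hy hyS, c.ambient.left_inv hy]

theorem contDiffOn_coord (c : SliceChartAt 𝕜 r F G x) :
    ContDiffOn 𝕜 r c.coord c.ambient.source :=
  (contDiff_fst.comp c.equiv.symm.contDiff).comp_contDiffOn c.contDiffOn

theorem contDiffOn_param (c : SliceChartAt 𝕜 r F G x) : ContDiffOn 𝕜 r c.param c.paramSource :=
  c.contDiffOn_symm.comp
    (c.equiv.contDiff.comp (contDiff_id.prodMk contDiff_const)).contDiffOn fun _ hu => hu

open Classical in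
/-- The chart of `S` induced by a slice chart at `x`. The inverse takes the junk value `x` outside
the domain of the parametrization. -/
noncomputable def chart (c : SliceChartAt 𝕜 r F G x) : OpenPartialHomeomorph S F where
  toFun y := c.coord y
  invFun u := if hu : u ∈ c.paramSource then ⟨c.param u, c.param_mem hu⟩ else x
  source := Subtype.val ⁻¹' c.ambient.source
  target := c.paramSource
  map_source' y hy := c.coord_mem_paramSource hy y.2
  map_target' u hu := by
    rw [dif_pos hu]
    exact c.param_mem_source hu
  left_inv' y hy := by
    simp only [dif_pos (c.coord_mem_paramSource hy y.2), c.param_coord hy y.2]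
  right_inv' u hu := by
    simp only [dif_pos hu, c.coord_param hu]
  open_source := c.ambient.open_source.preimage continuous_subtype_val
  open_target := c.ambient.open_target.preimage (by fun_prop)
  continuousOn_toFun :=
    c.contDiffOn_coord.continuousOn.comp continuous_subtype_val.continuousOn fun _ hy => hy
  continuousOn_invFun := by
    rw [IsInducing.subtypeVal.continuousOn_iff]
    refine c.contDiffOn_param.continuousOn.congr fun u hu => ?_
    simp only [Function.comp_apply, dif_pos hu]

theorem coe_chart_symm (c : SliceChartAt 𝕜 r F G x) {u : F} (hu : u ∈ c.paramSource) :
    (c.chart.symm u : E) = c.param u :=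
  congrArg Subtype.val (dif_pos hu)

theorem contDiffOn_chart_trans (c : SliceChartAt 𝕜 r F G x) (c' : SliceChartAt 𝕜 r F G x') :
    ContDiffOn 𝕜 r (c.chart.symm ≫ₕ c'.chart) (c.chart.symm ≫ₕ c'.chart).source := by
  have hsymm : EqOn (fun u => (c.chart.symm u : E)) c.param (c.chart.symm ≫ₕ c'.chart).source :=
    fun u hu => c.coe_chart_symm hu.1
  have hmaps : MapsTo c.param (c.chart.symm ≫ₕ c'.chart).source c'.ambient.source :=
    fun u hu => hsymm hu ▸ hu.2
  exact (c'.contDiffOn_coord.comp (c.contDiffOn_param.mono fun _ hu => hu.1) hmaps).congr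
    fun u hu => congrArg c'.coord (hsymm hu)

theorem ambient_mem_maximalAtlas (c : SliceChartAt 𝕜 r F G x) :
    c.ambient ∈ IsManifold.maximalAtlas 𝓘(𝕜, E) r E :=
  c.ambient.mem_maximalAtlas_of_contMDiffOn c.contDiffOn.contMDiffOn c.contDiffOn_symm.contMDiffOn

/-- The charted space structure on `S` whose charts are induced by slice charts at its points. -/
@[reducible]
noncomputable def chartedSpace (c : ∀ x : S, SliceChartAt 𝕜 r F G x) : ChartedSpace F S where
  atlas := range fun x => (c x).chart
  chartAt x := (c x).chart
  mem_chart_source x := (c x).mem_source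
  chart_mem_atlas x := mem_range_self x

theorem isManifold (c : ∀ x : S, SliceChartAt 𝕜 r F G x) :
    letI := chartedSpace c
    IsManifold 𝓘(𝕜, F) r S := by
  let _ := chartedSpace c
  refine isManifold_of_contDiffOn _ _ _ ?_
  rintro _ _ ⟨x, rfl⟩ ⟨x', rfl⟩
  simpa using (c x).contDiffOn_chart_trans (c x')

theorem isSmoothEmbedding_val (c : ∀ x : S, SliceChartAt 𝕜 r F G x) :
    letI := chartedSpace c
    Manifold.IsSmoothEmbedding 𝓘(𝕜, F) 𝓘(𝕜, E) r (Subtype.val : S → E) := by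
  let _ := chartedSpace c
  have := isManifold c
  refine ⟨Manifold.IsImmersionOfComplement.isImmersion (F := G) fun x => ?_, .subtypeVal⟩
  refine .mk_of_charts (c x).equiv (c x).chart (c x).ambient (c x).mem_source (c x).mem_source
    (IsManifold.chart_mem_maximalAtlas x) (c x).ambient_mem_maximalAtlas subset_rfl fun u hu => ?_
  have hu : u ∈ (c x).chart.target := by simpa using hu
  simpa [(c x).coe_chart_symm hu] using (c x).ambient_param hu

end SliceChartAt

end SliceChart

section EmbeddedSubmanifold

variable {E : Type*} [NormedAddCommGroup E] [NormedSpace ℝ E]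

theorem exists_isEmbeddedSubmanifold_of_sliceChartAt {G : Type*} [NormedAddCommGroup G]
    [NormedSpace ℝ G] {d : ℕ} {S : Set E}
    (c : ∀ x : S, SliceChartAt ℝ ∞ (EuclideanSpace ℝ (Fin d)) G x) :
    ∃ _ : ChartedSpace (EuclideanSpace ℝ (Fin d)) S, IsEmbeddedSubmanifold d S :=
  letI := SliceChartAt.chartedSpace c
  ⟨_, SliceChartAt.isManifold c, SliceChartAt.isSmoothEmbedding_val c⟩

theorem exists_euclideanSpace_prod_equiv_snd_eq_zero_iff [FiniteDimensional ℝ E]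
    (W : Submodule ℝ E) {d e : ℕ} (hd : finrank ℝ W = d) (he : finrank ℝ E = d + e) :
    ∃ L : (EuclideanSpace ℝ (Fin d) × EuclideanSpace ℝ (Fin e)) ≃L[ℝ] E,
      ∀ v, (L.symm v).2 = 0 ↔ v ∈ W := by
  obtain ⟨W', hW'⟩ := W.exists_isCompl
  have he' : finrank ℝ W' = e := by
    have := Submodule.finrank_add_eq_of_isCompl hW'
    lia
  let e₁ : EuclideanSpace ℝ (Fin d) ≃ₗ[ℝ] W := .ofFinrankEq _ _ (by simp [hd])
  let e₂ : EuclideanSpace ℝ (Fin e) ≃ₗ[ℝ] W' := .ofFinrankEq _ _ (by simp [he'])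
  refine ⟨((e₁.prodCongr e₂).trans (W.prodEquivOfIsCompl W' hW')).toContinuousLinearEquiv,
    fun v => ?_⟩
  exact e₂.symm.map_eq_zero_iff.trans (Submodule.prodEquivOfIsCompl_symm_apply_snd_eq_zero W W' hW')

theorem exists_isEmbeddedSubmanifold_of_locally_straightened [FiniteDimensional ℝ E] {d : ℕ}
    {S : Set E}
    (h : ∀ x ∈ S, ∃ (ψ : OpenPartialHomeomorph E E) (W : Submodule ℝ E), x ∈ ψ.source ∧
      ContDiffOn ℝ ∞ ψ ψ.source ∧ ContDiffOn ℝ ∞ ψ.symm ψ.target ∧ finrank ℝ W = d ∧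
      ∀ y ∈ ψ.source, ψ y ∈ W ↔ y ∈ S) :
    ∃ _ : ChartedSpace (EuclideanSpace ℝ (Fin d)) S, IsEmbeddedSubmanifold d S := by
  have hchart (x : S) : Nonempty (SliceChartAt ℝ ∞ (EuclideanSpace ℝ (Fin d))
      (EuclideanSpace ℝ (Fin (finrank ℝ E - d))) x) := by
    obtain ⟨ψ, W, hxψ, hψ, hψ', hW, hS⟩ := h x x.2
    have hd : finrank ℝ E = d + (finrank ℝ E - d) := by
      have := W.finrank_le
      lia
    obtain ⟨L, hL⟩ := exists_euclideanSpace_prod_equiv_snd_eq_zero_iff W hW hd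
    exact ⟨⟨ψ, L, hxψ, hψ, hψ', fun y hy => (hS y hy).symm.trans (hL _).symm⟩⟩
  exact exists_isEmbeddedSubmanifold_of_sliceChartAt fun x => (hchart x).some

namespace IsEmbeddedSubmanifold

variable {d : ℕ} {S : Set E} [ChartedSpace (EuclideanSpace ℝ (Fin d)) S]

theorem contMDiff_val (hS : IsEmbeddedSubmanifold d S) :
    ContMDiff (𝓡 d) 𝓘(ℝ, E) ∞ (Subtype.val : S → E) :=
  have := hS.isManifold
  hS.isSmoothEmbedding.isImmersion.contMDiff

theorem contMDiff_iff_val_comp (hS : IsEmbeddedSubmanifold d S)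
    {E' H M : Type*} [NormedAddCommGroup E'] [NormedSpace ℝ E'] [TopologicalSpace H]
    {I : ModelWithCorners ℝ E' H} [TopologicalSpace M] [ChartedSpace H M] [IsManifold I ∞ M]
    {f : M → S} :
    ContMDiff I (𝓡 d) ∞ f ↔ ContMDiff I 𝓘(ℝ, E) ∞ (Subtype.val ∘ f) := by
  have := hS.isManifold
  rw [ContMDiff.iff_comp_isImmersion hS.isSmoothEmbedding.isImmersion,
    and_iff_right_of_imp fun hf => IsInducing.subtypeVal.continuous_iff.2 hf.continuous]

end IsEmbeddedSubmanifold

end EmbeddedSubmanifold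

section Collinear

theorem collinear_iff_subset_line {k V P : Type*} [DivisionRing k] [AddCommGroup V] [Module k V]
    [AddTorsor V P] {s : Set P} {p q : P} (hp : p ∈ s) (hq : q ∈ s) (hpq : p ≠ q) :
    Collinear k s ↔ s ⊆ line[k, p, q] := by
  refine ⟨fun h x hx => h.mem_affineSpan_of_mem_of_ne hp hq hx hpq, fun h => ?_⟩
  have hline : Collinear k (line[k, p, q] : Set P) := by
    rw [Collinear, ← AffineSubspace.direction, direction_affineSpan]
    exact collinear_pair k p q
  exact hline.subset h

open scoped Pointwise in
theorem collinear_range_const_vadd_iff {k V P ι : Type*} [DivisionRing k] [AddCommGroup V]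
    [Module k V] [AddTorsor V P] (v : V) (p : ι → P) :
    Collinear k (range fun i => v +ᵥ p i) ↔ Collinear k (range p) := by
  have hrange : range (fun i => v +ᵥ p i) = v +ᵥ range p := range_comp (v +ᵥ ·) p
  rw [Collinear, Collinear, hrange, vectorSpan_vadd]

theorem div_mem_real_span_one_iff {a b c : ℂ} (hab : a ≠ b) :
    (c - a) / (b - a) ∈ ℝ ∙ (1 : ℂ) ↔ c ∈ line[ℝ, a, b] := by
  rw [show c = (c - a) +ᵥ a by simp, vadd_left_mem_affineSpan_pair, Submodule.mem_span_singleton]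
  refine exists_congr fun t => ?_
  rw [eq_div_iff (sub_ne_zero.2 hab.symm)]
  simp

end Collinear

theorem finrank_submodule_pi {K ι : Type*} [DivisionRing K] [Fintype ι] {V : ι → Type*}
    [∀ i, AddCommGroup (V i)] [∀ i, Module K (V i)] [∀ i, FiniteDimensional K (V i)]
    (p : ∀ i, Submodule K (V i)) :
    finrank K (Submodule.pi univ p) = ∑ i, finrank K (p i) := by
  let e : Submodule.pi univ p ≃ₗ[K] ∀ i, p i :=
    { Equiv.Set.univPi fun i => (p i : Set (V i)) with
      map_add' _ _ := rfl
      map_smul' _ _ := rfl }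
  rw [e.finrank_eq, finrank_pi_fintype]

section RelativeChart

variable {ι : Type*} [DecidableEq ι] {j k : ι}

/-- The coordinates `z j`, `z k - z j` and `(z i - z j) / (z k - z j)` for `i ≠ j, k` of a tuple
`z` with `z j ≠ z k`. -/
noncomputable def relativeCoord (j k : ι) (z : ι → ℂ) : ι → ℂ :=
  Function.update (Function.update (fun i => (z i - z j) / (z k - z j)) k (z k - z j)) j (z j)

/-- The tuple with given relative coordinates, see `relativeCoord`. -/
def ofRelativeCoord (j k : ι) (w : ι → ℂ) : ι → ℂ :=
  Function.update (Function.update (fun i => w i * w k + w j) k (w k + w j)) j (w j)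

theorem ofRelativeCoord_relativeCoord (hjk : j ≠ k) {z : ι → ℂ} (hz : z j ≠ z k) :
    ofRelativeCoord j k (relativeCoord j k z) = z := by
  have := sub_ne_zero.2 hz.symm
  ext i
  rcases eq_or_ne i j with rfl | hij
  · simp [ofRelativeCoord, relativeCoord]
  rcases eq_or_ne i k with rfl | hik <;>
    simp [ofRelativeCoord, relativeCoord, *, hjk.symm]

theorem relativeCoord_ofRelativeCoord (hjk : j ≠ k) {w : ι → ℂ} (hw : w k ≠ 0) :
    relativeCoord j k (ofRelativeCoord j k w) = w := by
  ext i
  rcases eq_or_ne i j with rfl | hij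
  · simp [ofRelativeCoord, relativeCoord]
  rcases eq_or_ne i k with rfl | hik <;>
    simp [ofRelativeCoord, relativeCoord, *, hjk.symm]

/-- The relative coordinates of the collinear tuples whose vertex `j` lies in `P`: coordinate `j`
is in `P`, coordinate `k` is arbitrary, and the others are real. -/
noncomputable def collinearSlice (P : Submodule ℝ ℂ) (j k : ι) : Submodule ℝ (ι → ℂ) :=
  Submodule.pi univ (Function.update (Function.update (fun _ => ℝ ∙ (1 : ℂ)) k ⊤) j P)

theorem mem_collinearSlice_iff {P : Submodule ℝ ℂ} {w : ι → ℂ} :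
    w ∈ collinearSlice P j k ↔ w j ∈ P ∧ ∀ i, i ≠ j → i ≠ k → w i ∈ ℝ ∙ (1 : ℂ) := by
  simp only [collinearSlice, Submodule.mem_pi, mem_univ, true_imp_iff]
  rw [Function.forall_update_iff _ fun i Q => w i ∈ Q]
  refine and_congr_right fun _ => forall_congr' fun i => imp_congr_right fun _ => ?_
  rcases eq_or_ne i k with rfl | hik <;> simp [*]

theorem relativeCoord_mem_collinearSlice_iff (P : Submodule ℝ ℂ) {z : ι → ℂ} (hz : z j ≠ z k) :
    relativeCoord j k z ∈ collinearSlice P j k ↔ Collinear ℝ (range z) ∧ z j ∈ P := by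
  rw [mem_collinearSlice_iff, and_comm,
    collinear_iff_subset_line (mem_range_self j) (mem_range_self k) hz, range_subset_iff]
  refine and_congr (forall_congr' fun i => ?_) (by simp [relativeCoord])
  rcases eq_or_ne i j with rfl | hij
  · simp [left_mem_affineSpan_pair]
  rcases eq_or_ne i k with rfl | hik
  · simp [right_mem_affineSpan_pair]
  · simp only [relativeCoord, ne_eq, hij, hik, not_false_eq_true, forall_const,
      Function.update_of_ne]
    exact div_mem_real_span_one_iff hz

variable [Fintype ι]

theorem contDiffOn_relativeCoord (j k : ι) :
    ContDiffOn ℝ ∞ (relativeCoord j k) {z | z j ≠ z k} := by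
  refine contDiffOn_pi.2 fun i => ?_
  simp only [relativeCoord, Function.update_apply]
  split_ifs
  · fun_prop
  · fun_prop
  · simp only [div_eq_mul_inv]
    exact ContDiffOn.mul (by fun_prop)
      (ContDiffOn.inv (by fun_prop) fun z hz => sub_ne_zero.2 (Ne.symm hz))

theorem contDiff_ofRelativeCoord (j k : ι) : ContDiff ℝ ∞ (ofRelativeCoord j k) := by
  refine contDiff_pi.2 fun i => ?_
  simp only [ofRelativeCoord, Function.update_apply]
  split_ifs <;> fun_prop

/-- The smooth chart of `ℂ^ι` with coordinate map `relativeCoord j k`. -/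
noncomputable def relativeChart (hjk : j ≠ k) : OpenPartialHomeomorph (ι → ℂ) (ι → ℂ) where
  toFun := relativeCoord j k
  invFun := ofRelativeCoord j k
  source := {z | z j ≠ z k}
  target := {w | w k ≠ 0}
  map_source' z hz := by simpa [relativeCoord, hjk.symm, sub_eq_zero] using Ne.symm hz
  map_target' w hw := by simpa [ofRelativeCoord, hjk.symm] using hw
  left_inv' _ hz := ofRelativeCoord_relativeCoord hjk hz
  right_inv' _ hw := relativeCoord_ofRelativeCoord hjk hw
  open_source := isOpen_ne_fun (by fun_prop) (by fun_prop)
  open_target := isOpen_ne_fun (by fun_prop) (by fun_prop)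
  continuousOn_toFun := (contDiffOn_relativeCoord j k).continuousOn
  continuousOn_invFun := (contDiff_ofRelativeCoord j k).continuous.continuousOn

theorem finrank_collinearSlice (P : Submodule ℝ ℂ) (hjk : j ≠ k) :
    finrank ℝ (collinearSlice P j k) = finrank ℝ P + Fintype.card ι := by
  have hcard : 2 ≤ Fintype.card ι := Fintype.one_lt_card_iff.2 ⟨j, k, hjk⟩
  have hk : k ∈ Finset.univ \ {j} := by simpa using hjk.symm
  have hcompl : (((Finset.univ : Finset ι) \ {j}) \ {k}).card = Fintype.card ι - 2 := by
    rw [Finset.card_sdiff_of_subset (by simpa using hk), Finset.card_sdiff_of_subset (by simp)]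
    simp only [Finset.card_univ, Finset.card_singleton]
    lia
  rw [collinearSlice, finrank_submodule_pi]
  simp only [Function.apply_update (fun _ (Q : Submodule ℝ ℂ) => finrank ℝ Q)]
  rw [Finset.sum_update_of_mem (Finset.mem_univ j), Finset.sum_update_of_mem hk, finrank_top,
    finrank_span_singleton one_ne_zero, Complex.finrank_real_complex, Finset.sum_const, hcompl]
  lia

end RelativeChart

section Segments

variable {n : ℕ} [NeZero n]

theorem mem_segmentSpace_iff {z : Fin n → ℂ} :
    z ∈ segmentSpace n ↔ Collinear ℝ (range z) ∧ ∃ k, z 0 ≠ z k := by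
  refine and_congr_right fun _ => ?_
  rw [← not_forall_not, not_iff_not]
  simp only [not_not]
  exact ⟨fun ⟨b, hb⟩ _ => hb ▸ rfl, fun h => ⟨z 0, funext h⟩⟩

theorem mem_firstVertexZero_iff {z : Fin n → ℂ} : z ∈ firstVertexZero n ↔ z 0 = 0 := by
  simp [firstVertexZero, Fin.val_eq_zero_iff]

theorem add_const_mem_segmentSpace {z : Fin n → ℂ} (hz : z ∈ segmentSpace n) (b : ℂ) :
    (z + fun _ => b) ∈ segmentSpace n := by
  rw [mem_segmentSpace_iff] at hz ⊢
  have hadd : (z + fun _ => b) = fun i => b +ᵥ z i := funext fun i => add_comm (z i) b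
  rw [hadd, collinear_range_const_vadd_iff]
  simpa using hz

theorem exists_isEmbeddedSubmanifold_segmentSpace_inter {d : ℕ} (P : Submodule ℝ ℂ)
    (hd : finrank ℝ P + n = d) :
    ∃ _ : ChartedSpace (EuclideanSpace ℝ (Fin d)) {z ∈ segmentSpace n | z 0 ∈ P},
      IsEmbeddedSubmanifold d {z ∈ segmentSpace n | z 0 ∈ P} := by
  refine exists_isEmbeddedSubmanifold_of_locally_straightened fun z hz => ?_
  obtain ⟨k, hzk⟩ := (mem_segmentSpace_iff.1 hz.1).2
  have hk : 0 ≠ k := ne_of_apply_ne z hzk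
  refine ⟨relativeChart hk, collinearSlice P 0 k, hzk, contDiffOn_relativeCoord 0 k,
    (contDiff_ofRelativeCoord 0 k).contDiffOn, ?_, fun y hy => ?_⟩
  · rw [finrank_collinearSlice P hk, Fintype.card_fin, hd]
  · refine (relativeCoord_mem_collinearSlice_iff P hy).trans (and_congr_left fun _ => ?_)
    rw [mem_segmentSpace_iff, and_iff_left ⟨k, hy⟩]

theorem exists_isEmbeddedSubmanifold_basedSegmentSpace :
    ∃ _ : ChartedSpace (EuclideanSpace ℝ (Fin n)) (basedSegmentSpace n),
      IsEmbeddedSubmanifold n (basedSegmentSpace n) := by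
  have hbot : basedSegmentSpace n = {z ∈ segmentSpace n | z 0 ∈ (⊥ : Submodule ℝ ℂ)} := by
    ext z
    simp [basedSegmentSpace, mem_firstVertexZero_iff]
  rw [hbot]
  exact exists_isEmbeddedSubmanifold_segmentSpace_inter ⊥ (by simp)

theorem exists_isEmbeddedSubmanifold_segmentSpace :
    ∃ _ : ChartedSpace (EuclideanSpace ℝ (Fin (n + 2))) (segmentSpace n),
      IsEmbeddedSubmanifold (n + 2) (segmentSpace n) := by
  have htop : segmentSpace n = {z ∈ segmentSpace n | z 0 ∈ (⊤ : Submodule ℝ ℂ)} := by simp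
  rw [htop]
  exact exists_isEmbeddedSubmanifold_segmentSpace_inter ⊤
    (by rw [finrank_top, Complex.finrank_real_complex, add_comm])

/-- Every segment is the translate by its first vertex of a unique based segment. -/
def basedSegmentTranslation (n : ℕ) [NeZero n] : basedSegmentSpace n × ℂ ≃ segmentSpace n where
  toFun p := ⟨p.1.1 + fun _ => p.2, add_const_mem_segmentSpace p.1.2.1 p.2⟩
  invFun z := (⟨z.1 + fun _ => -z.1 0, add_const_mem_segmentSpace z.2 _,
    mem_firstVertexZero_iff.2 (by simp)⟩, z.1 0)
  left_inv p := by
    ext <;> simp [mem_firstVertexZero_iff.1 p.1.2.2]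
  right_inv z := by
    ext
    simp

/-- The bijection `basedSegmentTranslation` as a diffeomorphism. -/
def basedSegmentDiffeomorph
    [ChartedSpace (EuclideanSpace ℝ (Fin n)) (basedSegmentSpace n)]
    [ChartedSpace (EuclideanSpace ℝ (Fin (n + 2))) (segmentSpace n)]
    (hM : IsEmbeddedSubmanifold n (basedSegmentSpace n))
    (hL : IsEmbeddedSubmanifold (n + 2) (segmentSpace n)) :
    Diffeomorph ((𝓡 n).prod 𝓘(ℝ, ℂ)) (𝓡 (n + 2)) (basedSegmentSpace n × ℂ) (segmentSpace n) ∞ where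
  toEquiv := basedSegmentTranslation n
  contMDiff_toFun := by
    have := hM.isManifold
    have hconst : ContDiff ℝ ∞ fun (b : ℂ) (_ : Fin n) => b := by fun_prop
    exact hL.contMDiff_iff_val_comp.2
      ((hM.contMDiff_val.comp contMDiff_fst).add (hconst.contMDiff.comp contMDiff_snd))
  contMDiff_invFun := by
    have := hL.isManifold
    have hbase : ContDiff ℝ ∞ fun z : Fin n → ℂ => z + fun _ => -z 0 := by fun_prop
    have hfirst : ContDiff ℝ ∞ fun z : Fin n → ℂ => z 0 := by fun_prop
    exact (hM.contMDiff_iff_val_comp.2 (hbase.contMDiff.comp hL.contMDiff_val)).prodMk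
      (hfirst.contMDiff.comp hL.contMDiff_val)

end Segments

theorem corollary2p2 (n : ℕ) (hn : 3 ≤ n) :
    ∃ (_ : ChartedSpace (EuclideanSpace ℝ (Fin n)) (basedSegmentSpace n))
      (_ : ChartedSpace (EuclideanSpace ℝ (Fin (n + 2))) (segmentSpace n)),
      IsEmbeddedSubmanifold n (basedSegmentSpace n) ∧
      IsEmbeddedSubmanifold (n + 2) (segmentSpace n) ∧
      ∃ Φ : Diffeomorph ((𝓡 n).prod 𝓘(ℝ, ℂ)) (𝓡 (n + 2))
          (basedSegmentSpace n × ℂ) (segmentSpace n) ∞,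
        ∀ (z : basedSegmentSpace n) (b : ℂ),
          (Φ (z, b) : Fin n → ℂ) = (z : Fin n → ℂ) + fun _ => b := by
  have : NeZero n := ⟨by lia⟩
  obtain ⟨_, hM⟩ := exists_isEmbeddedSubmanifold_basedSegmentSpace (n := n)
  obtain ⟨_, hL⟩ := exists_isEmbeddedSubmanifold_segmentSpace (n := n)
  exact ⟨_, _, hM, hL, basedSegmentDiffeomorph hM hL, fun _ _ => rfl⟩
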